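/- Let $(S,*)$ be a finite cycle set of size $n$: a finite set with a binary operation such that every map $\psi(s)\colon t\mapsto s*t$ is bijective and $(s*t)*(s*u)=(t*s)*(t*u)$ for all $s,t,u\in S$. Let $G=\langle S\mid s(s*t)=t(t*s),\ s\neq t\in S\rangle$ be its structure group. The group $G$ acts on $S$, hence on $\mathbb Z^S$, by $\lambda_s=\psi(s)^{-1}$ for $s\in S$, and there is a unique map $\mathrm{cp}\colon G\to\mathbb Z^S$ with $\mathrm{cp}(s)=e_s$ for $s\in S$ and $\mathrm{cp}(gh)=\mathrm{cp}(g)+\lambda_g(\mathrm{cp}(h))$ for $g,h\in G$; it is bijective. The addition of $\mathbb Z^S$, carried to $G$ along $\mathrm{cp}$, makes $G$ a brace. Write $s^{[k]}\in G$ for the $k$-fold sum of $s$ in $(G,+)$, so that $\mathrm{cp}(s^{[k]})=k\,e_s$, and let the Dehornoy class $d$ of $S$ be the least positive integer such that $s^{[d]}$ lies in the socle $\{a\in G\mid ab=a+b\text{ for all }b\in G\}$ for every $s\in S$. Let $R$ be a commutative ring and let $P=\sum_{k=0}^{l}a_kX^k\in R[X]$ be a polynomial of degree $l>0$ whose leading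 coefficient $a_l$ and constant coefficient $a_0$ are invertible in $R$. Let $\mathcal H(S,P)=R[G]/J_P$, where $J_P$ is the two-sided ideal of the group ring $R[G]$ generated by the elements $P(s^{[d]})$ with $s\in S$, and write $T_s$ for the image of $s\in S$ in $\mathcal H(S,P)$. Let $\overline G_l=G/\langle s^{[ld]} : s\in S\rangle$. A reduced expression of $g\in\overline G_l$ is a word $s_{1}\cdots s_{r}$ in the elements of $S$, of minimal length among such words, that represents $g$. Then every $g\in\overline G_l$ has a reduced expression; the element $T_g=T_{s_1}\cdots T_{s_r}\in\mathcal H(S,P)$, where $s_1\cdots s_r$ is a reduced expression of $g$, does not depend on the choice of that expression; and $\mathcal H(S,P)$ is a free $R$-module with basis $\{T_g\mid g\in\overline G_l\}$. In particular $\mathcal H(S,P)$ has finite rank $(ld)^n$ over $R$, which is also the order of $\overline G_l$. -/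

import Mathlib

open Polynomial

/-- A cycle set: a binary operation `s * t = op s t` whose left translations are bijective and
which satisfies `(s * t) * (s * u) = (t * s) * (t * u)`. -/
class CycleSet (S : Type*) where
  /-- the binary operation of the cycle set -/
  op : S → S → S
  op_bijective : ∀ s, Function.Bijective (op s)
  op_op : ∀ s t u, op (op s t) (op s u) = op (op t s) (op t u)

/-- A (left) brace: a group and an abelian group structure on the same set such that
`a (b + c) + a = a b + a c`. -/
class LeftBrace (B : Type*) [Group B] [AddCommGroup B] : Prop where
  mul_add_add : ∀ a b c : B, a * (b + c) + a = a * b + a * c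

/-- The socle of a brace: `Soc(B) = {a | ∀ b, a b = a + b}`. -/
def LeftBrace.socle (B : Type*) [Group B] [AddCommGroup B] : Set B :=
  {a | ∀ b : B, a * b = a + b}

namespace CycleSet

/-- The defining relators `s (s * t) (t (t * s))⁻¹`, `s ≠ t`, of the structure group. -/
def relators (S : Type*) [CycleSet S] : Set (FreeGroup S) :=
  {x | ∃ s t : S, s ≠ t ∧
    x = FreeGroup.of s * FreeGroup.of (op s t) * (FreeGroup.of t * FreeGroup.of (op t s))⁻¹}

/-- The structure group `G = ⟨S | s (s * t) = t (t * s), s ≠ t⟩` of a cycle set. -/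
def StructureGroup (S : Type*) [CycleSet S] : Type _ := PresentedGroup (relators S)

instance (S : Type*) [CycleSet S] : Group (StructureGroup S) :=
  inferInstanceAs (Group (PresentedGroup (relators S)))

section StructureGroup

variable {S : Type*}

/-- Permutation of the coordinates of `ℤ^S`; it sends `e_s` to `e_{σ s}`. -/
noncomputable def act (σ : Equiv.Perm S) : (S →₀ ℤ) ≃+ (S →₀ ℤ) := Finsupp.domCongr σ

theorem act_single (σ : Equiv.Perm S) (s : S) (k : ℤ) :
    act σ (Finsupp.single s k) = Finsupp.single (σ s) k := by
  simp [act]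

theorem act_apply (σ : Equiv.Perm S) (v : S →₀ ℤ) (s : S) : act σ v s = v (σ⁻¹ s) := rfl

theorem act_mul (σ τ : Equiv.Perm S) (v : S →₀ ℤ) : act (σ * τ) v = act σ (act τ v) := by
  ext s; simp [act_apply]

theorem act_one (v : S →₀ ℤ) : act 1 v = v := by
  ext s; simp [act_apply]

variable [CycleSet S]

/-- The generator of the structure group attached to `s : S`. -/
def gen (s : S) : StructureGroup S := PresentedGroup.of s

/-- The permutation `ψ(s) : t ↦ s * t`. -/
noncomputable def psi (s : S) : Equiv.Perm S := Equiv.ofBijective (op s) (op_bijective s)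

theorem psi_apply (s t : S) : psi s t = op s t := rfl

theorem gen_mul_gen (s t : S) : gen s * gen (op s t) = gen t * gen (op t s) := by
  by_cases h : s = t
  · subst h; rfl
  · have : PresentedGroup.mk (relators S)
        (FreeGroup.of s * FreeGroup.of (op s t) * (FreeGroup.of t * FreeGroup.of (op t s))⁻¹) = 1 :=
      PresentedGroup.one_of_mem ⟨s, t, h, rfl⟩
    rw [map_mul, map_inv, mul_inv_eq_one, map_mul, map_mul] at this
    exact this

theorem psi_mul_psi (s t : S) : psi (op s t) * psi s = psi (op t s) * psi t := by
  ext u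
  simp only [Equiv.Perm.mul_apply, psi_apply]
  exact op_op s t u

/-- The action of `G` on `S`, determined by `λ_s = ψ(s)⁻¹`. -/
noncomputable def lam : StructureGroup S →* Equiv.Perm S :=
  PresentedGroup.toGroup (f := fun s => (psi s)⁻¹) (by
    rintro _ ⟨s, t, -, rfl⟩
    simp only [map_mul, map_inv, FreeGroup.lift_apply_of]
    rw [mul_inv_eq_one, ← mul_inv_rev, ← mul_inv_rev, psi_mul_psi])

@[simp] theorem lam_gen (s : S) : lam (gen s) = (psi s)⁻¹ := PresentedGroup.toGroup.of _

/-- The affine permutation `v ↦ e_s + λ_s v` of `ℤ^S`. -/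
noncomputable def affGen (s : S) : Equiv.Perm (S →₀ ℤ) :=
  (act (psi s)⁻¹).toEquiv.trans (Equiv.addLeft (Finsupp.single s 1))

theorem affGen_apply (s : S) (v : S →₀ ℤ) :
    affGen s v = Finsupp.single s 1 + act (psi s)⁻¹ v := rfl

theorem affGen_mul (s t : S) : affGen s * affGen (op s t) = affGen t * affGen (op t s) := by
  have key : ∀ s t : S, ∀ v, (affGen s * affGen (op s t)) v = Finsupp.single s 1 +
      (Finsupp.single t 1 + act ((psi (op s t) * psi s)⁻¹) v) := by
    intro s t v
    have h : (psi s)⁻¹ (op s t) = t := by rw [← psi_apply]; simp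
    rw [Equiv.Perm.mul_apply, affGen_apply, affGen_apply, map_add, act_single, mul_inv_rev,
      act_mul, h]
  ext1 v
  rw [key, key, psi_mul_psi, add_left_comm]

/-- The action of `G` on `ℤ^S` by the affine maps `v ↦ cp(g) + λ_g v`. -/
noncomputable def aff : StructureGroup S →* Equiv.Perm (S →₀ ℤ) :=
  PresentedGroup.toGroup (f := affGen) (by
    rintro _ ⟨s, t, -, rfl⟩
    simp only [map_mul, map_inv, FreeGroup.lift_apply_of]
    rw [mul_inv_eq_one, affGen_mul])

theorem aff_gen (s : S) : aff (gen s) = affGen s := PresentedGroup.toGroup.of _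

/-- The 1-cocycle `cp : G → ℤ^S`, determined by `cp(s) = e_s` and
`cp(g h) = cp(g) + λ_g (cp(h))`. -/
noncomputable def cp (g : StructureGroup S) : S →₀ ℤ := aff g 0

theorem gen_induction {p : StructureGroup S → Prop} (one : p 1)
    (mul_gen : ∀ g s, p g → p (g * gen s)) (mul_inv : ∀ g s, p g → p (g * (gen s)⁻¹))
    (g : StructureGroup S) : p g := by
  have htop : Subgroup.closure (Set.range (gen (S := S))) = ⊤ :=
    PresentedGroup.closure_range_of (relators S)
  have hg : g ∈ Subgroup.closure (Set.range (gen (S := S))) := by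
    rw [htop]; trivial
  induction hg using Subgroup.closure_induction_right with
  | one => exact one
  | mul_right x _ y hy ih => obtain ⟨s, rfl⟩ := hy; exact mul_gen _ _ ih
  | mul_inv_cancel x _ y hy ih => obtain ⟨s, rfl⟩ := hy; exact mul_inv _ _ ih

theorem aff_apply (g : StructureGroup S) : ∀ v, aff g v = cp g + act (lam g) v := by
  induction g using gen_induction with
  | one => intro v; simp [cp, act_one]
  | mul_gen g s ih =>
    intro v
    have h1 : cp (g * gen s) = cp g + act (lam g) (Finsupp.single s 1) := by
      rw [cp, map_mul, Equiv.Perm.mul_apply, ih, aff_gen, affGen_apply, map_zero, add_zero]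
    rw [map_mul, Equiv.Perm.mul_apply, ih, aff_gen, affGen_apply, h1, map_mul, act_mul, map_add,
      lam_gen, add_assoc]
  | mul_inv g s ih =>
    intro v
    have h0 : ∀ v, aff (gen s)⁻¹ v = act (psi s) (v - Finsupp.single s 1) := by
      intro v
      rw [map_inv, Equiv.Perm.inv_eq_iff_eq, aff_gen, affGen_apply, ← act_mul]
      simp [act_one]
    have h1 : cp (g * (gen s)⁻¹) = cp g + act (lam g) (act (psi s) (0 - Finsupp.single s 1)) := by
      rw [cp, map_mul, Equiv.Perm.mul_apply, ih, h0]
    rw [map_mul, Equiv.Perm.mul_apply, ih, h0, h1, map_mul, act_mul, map_inv, lam_gen, inv_inv,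
      add_assoc, ← map_add, ← map_add]
    congr 3
    abel

theorem cp_mul (g h : StructureGroup S) : cp (g * h) = cp g + act (lam g) (cp h) := by
  rw [← aff_apply, cp, map_mul]; rfl

@[simp] theorem cp_one : cp (1 : StructureGroup S) = 0 := by simp [cp]

@[simp] theorem cp_gen (s : S) : cp (gen s) = Finsupp.single s 1 := by
  rw [cp, aff_gen, affGen_apply, map_zero, add_zero]

theorem cp_inv (g : StructureGroup S) : cp g⁻¹ = - act (lam g)⁻¹ (cp g) := by
  have h := cp_mul g⁻¹ g
  rw [inv_mul_cancel, cp_one, map_inv] at h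
  exact eq_neg_of_add_eq_zero_left h.symm

/-- The element of `G` represented by a word in the generators. -/
def word (w : List S) : StructureGroup S := (w.map gen).prod

theorem word_append (w w' : List S) : word (w ++ w') = word w * word w' := by simp [word]

theorem word_snoc (w : List S) (s : S) : word (w ++ [s]) = word w * gen s := by simp [word]

theorem cp_mul_gen (g : StructureGroup S) (s : S) :
    cp (g * gen s) = cp g + Finsupp.single (lam g s) 1 := by
  rw [cp_mul, cp_gen, act_single]

theorem exists_word_cp (v : S →₀ ℤ) (hv : ∀ s, 0 ≤ v s) : ∃ w : List S, cp (word w) = v := by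
  have key : ∀ f : S →₀ ℕ, ∃ w : List S,
      cp (word w) = f.mapRange (fun n : ℕ => (n : ℤ)) Nat.cast_zero := by
    intro f
    induction f using Finsupp.induction with
    | zero => exact ⟨[], by simp [word]⟩
    | single_add s k f _ _ ih =>
      clear * - ih
      induction k with
      | zero => simpa using ih
      | succ k ihk =>
        obtain ⟨w, hw⟩ := ihk
        refine ⟨w ++ [(lam (word w))⁻¹ s], ?_⟩
        rw [word_snoc, cp_mul_gen, hw]
        ext t
        by_cases hst : s = t
        · subst hst; simp; ring
        · simp [hst]
  obtain ⟨w, hw⟩ := key (v.mapRange Int.toNat rfl)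
  refine ⟨w, hw.trans ?_⟩
  ext s
  simp [hv s]

theorem cp_word_nonneg (w : List S) (s : S) : 0 ≤ cp (word w) s := by
  induction w using List.reverseRecOn with
  | nil => simp [word]
  | append_singleton w t ih =>
    rw [word_snoc, cp_mul_gen, Finsupp.add_apply]
    have : (0 : ℤ) ≤ Finsupp.single (lam (word w) t) (1 : ℤ) s := by
      classical
      rw [Finsupp.single_apply]; split <;> norm_num
    omega

theorem degree_cp_word (w : List S) : (cp (word w)).degree = w.length := by
  induction w using List.reverseRecOn with
  | nil => simp [word]
  | append_singleton w t ih =>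
    rw [word_snoc, cp_mul_gen, map_add, ih]; simp

theorem word_eq_of_cp_eq (n : ℕ) : ∀ w w' : List S, w.length = n →
    cp (word w) = cp (word w') → word w = word w' := by
  induction n with
  | zero =>
    intro w w' hw h
    have hl : (w.length : ℤ) = w'.length := by rw [← degree_cp_word, h, degree_cp_word]
    have h1 : w = [] := List.length_eq_zero_iff.mp hw
    have h2 : w' = [] := List.length_eq_zero_iff.mp (by omega)
    rw [h1, h2]
  | succ n ih =>
    intro w w' hw h
    have hl : (w.length : ℤ) = w'.length := by rw [← degree_cp_word, h, degree_cp_word]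
    obtain rfl | ⟨w1, a, rfl⟩ := List.eq_nil_or_concat' w
    · simp at hw
    obtain rfl | ⟨w2, b, rfl⟩ := List.eq_nil_or_concat' w'
    · simp at hl; omega
    simp only [List.length_append, List.length_singleton] at hw hl
    rw [word_snoc, word_snoc] at h ⊢
    rw [cp_mul_gen, cp_mul_gen] at h
    set s := lam (word w1) a with hs
    set t := lam (word w2) b with ht
    by_cases hst : s = t
    · rw [hst, add_left_inj] at h
      have e := ih w1 w2 (by omega) h
      rw [e] at hs ⊢
      rw [show a = b from (lam (word w2)).injective (by rw [← hs, ← ht, hst])]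
    · obtain ⟨u, hu⟩ := exists_word_cp (cp (word w1) - Finsupp.single t 1) (by
        intro x
        by_cases hx : x = t
        · have := DFunLike.congr_fun h x
          have h2 := cp_word_nonneg w2 x
          rw [hx] at this h2 ⊢
          rw [Finsupp.add_apply, Finsupp.add_apply, Finsupp.single_eq_same,
            Finsupp.single_eq_of_ne (Ne.symm hst)] at this
          rw [Finsupp.sub_apply, Finsupp.single_eq_same]
          omega
        · have h1 := cp_word_nonneg w1 x
          simpa [Finsupp.single_apply, Ne.symm hx] using h1)
      have hu2 : cp (word u) = cp (word w2) - Finsupp.single s 1 := by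
        rw [hu, sub_eq_sub_iff_add_eq_add, h]
      set p := (lam (word u))⁻¹ t with hp
      set q := (lam (word u))⁻¹ s with hq
      have e1 : word w1 = word u * gen p := by
        rw [← word_snoc]
        refine ih _ _ (by omega) ?_
        rw [word_snoc, cp_mul_gen, hu, hp]; simp
      have e2 : word w2 = word u * gen q := by
        rw [← word_snoc]
        refine ih _ _ (by omega) ?_
        rw [word_snoc, cp_mul_gen, hu2, hq]; simp
      have ha : a = op p q := by
        rw [hq, hs, e1, map_mul, lam_gen, Equiv.Perm.mul_apply, ← psi_apply]; simp
      have hb : b = op q p := by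
        rw [hp, ht, e2, map_mul, lam_gen, Equiv.Perm.mul_apply, ← psi_apply]; simp
      rw [e1, e2, ha, hb, mul_assoc, mul_assoc, gen_mul_gen]

theorem exists_word_eq_pow (w : List S) (k : ℕ) : ∃ w' : List S, word w' = word w ^ k := by
  induction k with
  | zero => exact ⟨[], by simp [word]⟩
  | succ k ih =>
    obtain ⟨w', h⟩ := ih
    exact ⟨w' ++ w, by rw [word_append, h, pow_succ]⟩

theorem word_mul_comm_of_lam (z y : List S) (hz : lam (word z) = 1) (hy : lam (word y) = 1) :
    word z * word y = word y * word z := by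
  rw [← word_append, ← word_append]
  refine word_eq_of_cp_eq _ _ _ rfl ?_
  rw [word_append, word_append, cp_mul, cp_mul, hz, hy, act_one, act_one, add_comm]

theorem exists_eq_inv_mul [Finite S] (g : StructureGroup S) :
    ∃ b a : List S, g = (word b)⁻¹ * word a := by
  have ore : ∀ (a : List S) (s : S), ∃ b a' : List S, word b * word a = word a' * gen s := by
    intro a s
    have hpos : 0 < Nat.card (Equiv.Perm S) := Nat.card_pos
    obtain ⟨m, hm⟩ : ∃ m, Nat.card (Equiv.Perm S) = m + 1 := ⟨_, (Nat.succ_pred_eq_of_pos hpos).symm⟩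
    have hker : ∀ w : List S, lam (word w ^ (m + 1)) = 1 := by
      intro w; rw [map_pow, ← hm, pow_card_eq_one']
    have hs : word [s] = gen s := by simp [word]
    obtain ⟨a1, h1⟩ := exists_word_eq_pow a (m + 1)
    obtain ⟨s1, h2⟩ := exists_word_eq_pow [s] (m + 1)
    obtain ⟨a2, h3⟩ := exists_word_eq_pow a m
    obtain ⟨s2, h4⟩ := exists_word_eq_pow [s] m
    refine ⟨s1 ++ a2, a1 ++ s2, ?_⟩
    have := word_mul_comm_of_lam s1 a1 (by rw [h2]; exact hker _) (by rw [h1]; exact hker _)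
    rw [word_append, word_append, h3, h4, mul_assoc, ← pow_succ, mul_assoc, hs, ← pow_succ, ← hs,
      ← h1, ← h2, this]
  induction g using gen_induction with
  | one => exact ⟨[], [], by simp [word]⟩
  | mul_gen g s ih =>
    obtain ⟨b, a, rfl⟩ := ih
    exact ⟨b, a ++ [s], by rw [word_snoc, mul_assoc]⟩
  | mul_inv g s ih =>
    obtain ⟨b, a, rfl⟩ := ih
    obtain ⟨c, a', h⟩ := ore a s
    refine ⟨c ++ b, a', ?_⟩
    have h' : word a * (gen s)⁻¹ = (word c)⁻¹ * word a' := by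
      rw [eq_inv_mul_iff_mul_eq, ← mul_assoc, h, mul_inv_cancel_right]
    rw [word_append, mul_inv_rev, mul_assoc, h', mul_assoc]

theorem cp_injective [Finite S] : Function.Injective (cp (S := S)) := by
  intro g h hgh
  have h0 : cp (g⁻¹ * h) = 0 := by
    rw [cp_mul, cp_inv, hgh, map_inv, neg_add_cancel]
  obtain ⟨b, a, e⟩ := exists_eq_inv_mul (g⁻¹ * h)
  have h1 : word a = word b * (g⁻¹ * h) := by rw [e]; group
  have h2 : word b = word a := by
    refine word_eq_of_cp_eq _ _ _ rfl ?_
    rw [h1, cp_mul, h0, map_zero, add_zero]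
  rw [h2, inv_mul_cancel] at e
  exact (inv_mul_eq_one.mp e)

theorem exists_lam_eq_one [Finite S] (s : S) : ∃ (y : StructureGroup S) (m : ℕ), lam y = 1 ∧
    cp y = Finsupp.single s ((m : ℤ) + 1) := by
  have hw : ∀ k : ℕ, ∃ g : StructureGroup S, cp g = Finsupp.single s (k : ℤ) := by
    intro k
    obtain ⟨w, hw⟩ := exists_word_cp (Finsupp.single s (k : ℤ)) (by
      classical
      intro t; rw [Finsupp.single_apply]; split <;> omega)
    exact ⟨word w, hw⟩
  choose g hg using hw
  obtain ⟨i, j, hij, e⟩ := Finite.exists_ne_map_eq_of_infinite (fun k : ℕ => lam (g k))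
  replace e : lam (g i) = lam (g j) := e
  wlog hlt : i < j generalizing i j
  · exact this j i hij.symm e.symm (by omega)
  refine ⟨g j * (g i)⁻¹, j - i - 1, ?_, ?_⟩
  · rw [map_mul, map_inv, e, mul_inv_cancel]
  · rw [cp_mul, cp_inv, hg, hg, e, map_neg, ← act_mul, mul_inv_cancel, act_one,
      ← sub_eq_add_neg, ← Finsupp.single_sub]
    congr 1
    omega

theorem cp_surjective [Finite S] : Function.Surjective (cp (S := S)) := by
  have hadd : ∀ (v : S →₀ ℤ) (s : S) (k : ℕ), v ∈ Set.range (cp (S := S)) →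
      Finsupp.single s (k : ℤ) + v ∈ Set.range (cp (S := S)) := by
    intro v s k hv
    induction k with
    | zero => simpa using hv
    | succ k ih =>
      obtain ⟨g, hg⟩ := ih
      refine ⟨g * gen ((lam g)⁻¹ s), ?_⟩
      rw [cp_mul_gen, hg]
      push_cast
      rw [Finsupp.single_add]
      rw [← Equiv.Perm.mul_apply, mul_inv_cancel, Equiv.Perm.one_apply]
      abel
  have hsub : ∀ (v : S →₀ ℤ) (s : S) (k : ℕ), v ∈ Set.range (cp (S := S)) →
      Finsupp.single s (-(k : ℤ)) + v ∈ Set.range (cp (S := S)) := by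
    intro v s k hv
    induction k with
    | zero => simpa using hv
    | succ k ih =>
      obtain ⟨y, m, hy, hc⟩ := exists_lam_eq_one s
      obtain ⟨g, hg⟩ := ih
      have h1 : cp (y⁻¹ * g) = Finsupp.single s (-(k : ℤ)) + v - Finsupp.single s ((m : ℤ) + 1) := by
        rw [cp_mul, cp_inv, map_inv, hy, inv_one, act_one, act_one, hc, hg]; abel
      have h2 := hadd _ s m ⟨_, h1⟩
      convert h2 using 1
      rw [Finsupp.single_add]
      push_cast
      rw [neg_add, Finsupp.single_add, Finsupp.single_neg s (1 : ℤ)]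
      abel
  intro v
  change v ∈ Set.range (cp (S := S))
  induction v using Finsupp.induction with
  | zero => exact ⟨1, cp_one⟩
  | single_add s k v _ _ ih =>
    obtain ⟨n, rfl | rfl⟩ := Int.eq_nat_or_neg k
    · exact hadd _ _ _ ih
    · exact hsub _ _ _ ih

end StructureGroup

section Brace

variable (S : Type*) [CycleSet S] [Finite S]

/-- The bijective 1-cocycle `cp : G → ℤ^S`; its inverse is `Π : ℤ^S → G`. -/
noncomputable def cpEquiv : StructureGroup S ≃ (S →₀ ℤ) :=
  Equiv.ofBijective cp ⟨cp_injective, cp_surjective⟩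

/-- The additive group of the structure brace: the addition of `ℤ^S` carried to `G` by the
bijective 1-cocycle. In particular `k • gen s` is the element `s^{[k]}` of `G`. -/
noncomputable instance : AddCommGroup (StructureGroup S) := (cpEquiv S).addCommGroup

theorem cp_add (a b : StructureGroup S) : cp (a + b) = cp a + cp b :=
  (cpEquiv S).apply_symm_apply _

theorem cp_nsmul (k : ℕ) (a : StructureGroup S) : cp (k • a) = k • cp a :=
  (cpEquiv S).apply_symm_apply _

instance : LeftBrace (StructureGroup S) where
  mul_add_add a b c := by
    apply cp_injective
    simp only [cp_add, cp_mul, map_add]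
    abel

/-- In the structure brace `s (s * t) = s + t`, that is `λ_s⁻¹(t) = s * t`. -/
theorem gen_mul_gen_op (s t : S) : gen s * gen (op s t) = gen s + gen t := by
  apply cp_injective
  rw [cp_mul_gen, cp_add, cp_gen, cp_gen, lam_gen, ← psi_apply]
  simp

/-- The Dehornoy class of a finite cycle set: the least positive `d` such that `d s` lies in the
socle of the structure brace for all `s`. -/
noncomputable def dehornoyClass : ℕ :=
  sInf {d : ℕ | 0 < d ∧ ∀ s : S, d • gen s ∈ LeftBrace.socle (StructureGroup S)}

theorem mem_socle_of_lam (a : StructureGroup S) (ha : lam a = 1) :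
    a ∈ LeftBrace.socle (StructureGroup S) := by
  intro b
  apply cp_injective
  rw [cp_mul, cp_add, ha, act_one]

/-- The Dehornoy class is well defined. -/
theorem dehornoyClass_spec :
    0 < dehornoyClass S ∧
      ∀ s : S, dehornoyClass S • gen s ∈ LeftBrace.socle (StructureGroup S) := by
  refine Nat.sInf_mem (s := {d : ℕ | 0 < d ∧
    ∀ s : S, d • gen s ∈ LeftBrace.socle (StructureGroup S)}) ?_
  choose y m hy hc using exists_lam_eq_one (S := S)
  have := Fintype.ofFinite S
  refine ⟨∏ s, (m s + 1), Finset.prod_pos fun s _ => Nat.succ_pos _, fun s => ?_⟩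
  obtain ⟨k, hk⟩ := Finset.dvd_prod_of_mem (fun s => m s + 1) (Finset.mem_univ s)
  have hpow : ∀ k : ℕ, cp (y s ^ k) = k • cp (y s) := by
    intro k
    induction k with
    | zero => simp
    | succ k ih => rw [pow_succ, cp_mul, ih, map_pow, hy, one_pow, act_one, succ_nsmul]
  have h : (∏ s, (m s + 1)) • gen s = y s ^ k := by
    apply cp_injective
    rw [hk, hpow, cp_nsmul, cp_gen, hc, mul_comm, mul_nsmul']
    congr 1
    simp
  rw [h]
  exact mem_socle_of_lam S _ (by rw [map_pow, hy, one_pow])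

/-- The quotient `G / ⟨s^{[l d]} : s ∈ S⟩`, where `d` is the Dehornoy class. -/
abbrev Germ (l : ℕ) : Type _ :=
  StructureGroup S ⧸ Subgroup.normalClosure
    (Set.range fun s : S => (l * dehornoyClass S) • (gen s : StructureGroup S))

/-- The element of the germ represented by a word in the generators. -/
def germWord {S : Type*} [CycleSet S] [Finite S] (l : ℕ) (w : List S) : Germ S l :=
  QuotientGroup.mk (word w)

/-- `w` is a reduced expression of `g` in the germ: it represents `g`, and no shorter word in the
generators does. -/
def IsReducedExpr {S : Type*} [CycleSet S] [Finite S] (l : ℕ) (w : List S) (g : Germ S l) : Prop :=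
  germWord l w = g ∧ ∀ w' : List S, germWord l w' = g → w.length ≤ w'.length

/-- The two-sided ideal of `R[G]` generated by the elements `P(s^{[d]})`, `s ∈ S`. -/
noncomputable def heckeIdeal {R : Type*} [CommRing R] (P : R[X]) :
    TwoSidedIdeal (MonoidAlgebra R (StructureGroup S)) :=
  TwoSidedIdeal.span (Set.range fun s : S =>
    aeval (MonoidAlgebra.of R (StructureGroup S) (dehornoyClass S • gen s)) P)

/-- The Hecke algebra `H(S, P) = R[G] / (P(s^{[d]}) : s ∈ S)`. -/
abbrev HeckeAlgebra {R : Type*} [CommRing R] (P : R[X]) : Type _ :=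
  (heckeIdeal S P).ringCon.Quotient

/-- The image `T_s` in the Hecke algebra of the generator `s`. -/
noncomputable def heckeGen {S : Type*} [CycleSet S] [Finite S] {R : Type*} [CommRing R]
    (P : R[X]) (s : S) : HeckeAlgebra S P :=
  (heckeIdeal S P).ringCon.mk' (MonoidAlgebra.of R (StructureGroup S) (gen s))

end Brace

end CycleSet

-- The cocycle `cp` identifies `G` with the lattice `ℤ^S`. Elements of the socle act trivially on
-- `S`, so inserting a power of `s^{[d]}` between `a` and `b` only translates `cp (a * b)` by a
-- multiple of `d` along the coordinate `λ_a(s)` (`cp_mul_dehornoyClass_nsmul_pow_mul`). Hence, as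
-- an `R`-module, the two-sided ideal `J_P` is the ideal of the Laurent polynomials `R[X_s^{±1}]`
-- generated by the `P(X_s^d)`, and `H(S, P)` looks like the tensor power over `S` of
-- `R[X^{±1}]/(P(X^d))`. As the extreme coefficients of `P` are units, this factor is free on `1, X,
-- …, X^{ld-1}`.
--
-- The same lattice picture describes the germ: the kernel of `G → Germ S l` is `(ldℤ)^S`
-- (`mem_normalClosure_iff`), so every class has a unique representative `germLift` in the box `{0,
-- …, ld-1}^S`. The length of a word is the degree of its `cp`, and the box representative is
-- coordinatewise minimal among the words of its class. Reduced expressions are therefore exactly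
-- the words for that one element of `G` (`IsReducedExpr.word_eq`), which makes `T_g` well defined
-- as the image of `germLift g`.
--
-- These images span because the relations are linear recurrences solvable in both directions
-- (`span_heckeOf_germLift`). They are independent because a linear map to the tensor power sends
-- them to a product basis (`linearIndependent_heckeOf_germLift`).

universe u

/-! ### One-variable preliminaries on `P(X^d)`. -/

/-- The root of a polynomial `P(X ^ d)` whose extreme coefficients are invertible, adjoined to `R`. -/
theorem Polynomial.exists_unit_powerBasis_aeval_pow {R : Type u} [CommRing R] (P : R[X])
    (hlead : IsUnit P.leadingCoeff) (hconst : IsUnit (P.coeff 0))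
    {d : ℕ} (hd : 0 < d) :
    ∃ (B : Type u) (_ : CommRing B) (_ : Algebra R B) (x : Bˣ)
      (b : Module.Basis (Fin (P.natDegree * d)) R B),
      (∀ i, b i = (x : B) ^ (i : ℕ)) ∧ aeval ((x : B) ^ d) P = 0 := by
  obtain ⟨u, hu⟩ := hlead
  -- `Q` is `P(X^d)` divided by its leading coefficient; being monic, it gives a power basis of
  -- `AdjoinRoot Q`.
  obtain ⟨Q, hQ⟩ : ∃ Q : R[X], Q = C (↑u⁻¹ : R) * expand R d P := ⟨_, rfl⟩
  have hcop : (↑u⁻¹ : R) * (expand R d P).leadingCoeff = 1 := by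
    rw [leadingCoeff_expand hd, ← hu, Units.inv_mul]
  have hmonic : Q.Monic := hQ ▸ monic_C_mul_of_mul_leadingCoeff_eq_one hcop
  have hdeg : Q.natDegree = P.natDegree * d := by
    rw [hQ, natDegree_C_mul_of_isUnit u⁻¹.isUnit, natDegree_expand]
  have hzero : aeval (AdjoinRoot.root Q ^ d) P = 0 := by
    have h : aeval (AdjoinRoot.root Q) Q = 0 := by rw [AdjoinRoot.aeval_eq, AdjoinRoot.mk_self]
    rw [← expand_aeval]
    have h2 : expand R d P = C (u : R) * Q := by
      rw [hQ, ← mul_assoc, ← C_mul, Units.mul_inv, C_1, one_mul]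
    rw [h2, map_mul, h, mul_zero]
  have hunit : IsUnit (AdjoinRoot.root Q) := by
    -- Since `P(x^d) = 0`, the product of `x^d` with the value of `P.divX` there is `-a_0`, a unit.
    rw [← isUnit_pow_iff hd.ne']
    have h := hzero
    rw [← divX_mul_X_add P, map_add, map_mul, aeval_X, aeval_C] at h
    have h2 := hconst.map (algebraMap R (AdjoinRoot Q))
    rw [← neg_eq_of_add_eq_zero_right h, IsUnit.neg_iff] at h2
    exact isUnit_of_mul_isUnit_right h2
  refine ⟨AdjoinRoot Q, inferInstance, inferInstance, hunit.unit,
    (AdjoinRoot.powerBasis' hmonic).basis.reindex (finCongr hdeg), fun i => ?_, hzero⟩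
  rw [Module.Basis.reindex_apply, PowerBasis.basis_eq_pow]
  rfl

/-- A submodule containing `m` consecutive terms of a sequence indexed by `ℤ` contains all of them,
if the sequence satisfies a linear recurrence whose extreme coefficients are invertible. -/
theorem Submodule.mem_of_linear_recurrence {R M : Type*} [CommRing R] [AddCommGroup M] [Module R M]
    (N : Submodule R M) (P : R[X]) (hlead : IsUnit P.leadingCoeff) (hconst : IsUnit (P.coeff 0))
    {d : ℕ} (hd : 0 < d) (f : ℤ → M)
    (hrec : ∀ m : ℤ, ∑ k ∈ Finset.range (P.natDegree + 1), P.coeff k • f (m + k * d) = 0)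
    (hbox : ∀ m : ℤ, 0 ≤ m → m < P.natDegree * d → f m ∈ N) (m : ℤ) : f m ∈ N := by
  have hd' : (0 : ℤ) < d := by exact_mod_cast hd
  have hup : ∀ n : ℕ, f n ∈ N := by
    intro n
    induction n using Nat.strong_induction_on with
    | _ n ih =>
      by_cases hn : (n : ℤ) < P.natDegree * d
      · exact hbox n (by positivity) hn
      -- The recurrence starting at `n - ld` has `f n` as its top term; the other indices lie in
      -- `[0, n)`.
      · have h := hrec (n - P.natDegree * d)
        rw [Finset.sum_range_succ, sub_add_cancel, coeff_natDegree] at h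
        rw [← N.smul_mem_iff_of_isUnit hlead, ← neg_eq_of_add_eq_zero_right h]
        refine N.neg_mem (N.sum_mem fun k hk => N.smul_mem _ ?_)
        rw [Finset.mem_range] at hk
        have h1 : (k : ℤ) * d < P.natDegree * d :=
          mul_lt_mul_of_pos_right (by exact_mod_cast hk) hd'
        have h2 : (0 : ℤ) ≤ k * d := by positivity
        have := ih (n - P.natDegree * d + k * d : ℤ).toNat (by omega)
        rwa [Int.toNat_of_nonneg (by omega)] at this
  have hdown : ∀ n : ℕ, ∀ m : ℤ, -m ≤ n → f m ∈ N := by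
    intro n
    induction n with
    | zero =>
      intro m hm
      have := hup m.toNat
      rwa [Int.toNat_of_nonneg (by simpa using hm)] at this
    | succ n ih =>
      intro m hm
      -- Here `f m` is the lowest term; all other indices exceed `m` because `d > 0`.
      have h := hrec m
      rw [Finset.sum_range_succ'] at h
      simp only [Nat.cast_zero, zero_mul, add_zero] at h
      rw [← N.smul_mem_iff_of_isUnit hconst, ← neg_eq_of_add_eq_zero_right h]
      refine N.neg_mem (N.sum_mem fun k _ => N.smul_mem _ (ih _ ?_))
      have h1 : (d : ℤ) ≤ (k + 1 : ℕ) * d := le_mul_of_one_le_left hd'.le (by push_cast; omega)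
      push_cast at hm h1 ⊢
      omega
  exact hdown (-m).toNat m (Int.self_le_toNat _)

namespace CycleSet

theorem degree_nonneg_of_forall_nonneg {S : Type*} {v : S →₀ ℤ} (hv : ∀ s, 0 ≤ v s) : 0 ≤ v.degree := by
  rw [Finsupp.degree_apply]
  exact Finset.sum_nonneg fun s _ => hv s

/-! ### The elements `s^{[d]}` and the kernel of `G → Germ S l`. -/

variable {S : Type*} [CycleSet S] [Finite S]

theorem lam_eq_one_of_mem_socle {a : StructureGroup S}
    (ha : a ∈ LeftBrace.socle (StructureGroup S)) : lam a = 1 := by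
  ext t
  have h := congr_arg cp (ha (gen t))
  rw [cp_mul_gen, cp_add, cp_gen, add_right_inj] at h
  exact Finsupp.single_left_injective one_ne_zero h

theorem lam_dehornoyClass_nsmul (s : S) : lam (dehornoyClass S • gen s) = 1 :=
  lam_eq_one_of_mem_socle ((dehornoyClass_spec S).2 s)

theorem cp_dehornoyClass_nsmul (s : S) :
    cp (dehornoyClass S • gen s) = Finsupp.single s (dehornoyClass S : ℤ) := by
  rw [cp_nsmul, cp_gen]; simp

theorem lam_dehornoyClass_nsmul_pow (s : S) (k : ℕ) :
    lam ((dehornoyClass S • gen s) ^ k) = 1 := by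
  rw [map_pow, lam_dehornoyClass_nsmul, one_pow]

theorem cp_dehornoyClass_nsmul_pow (s : S) (k : ℕ) :
    cp ((dehornoyClass S • gen s) ^ k) = Finsupp.single s ((k : ℤ) * dehornoyClass S) := by
  induction k with
  | zero => simp
  | succ k ih =>
    rw [pow_succ, cp_mul, ih, lam_dehornoyClass_nsmul_pow, act_one, cp_dehornoyClass_nsmul,
      ← Finsupp.single_add]
    congr 1; push_cast; ring

/-- Additive multiples of `s^{[d]}` agree with its multiplicative powers because it acts trivially.
-/
theorem mul_dehornoyClass_nsmul (l : ℕ) (s : S) :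
    (l * dehornoyClass S) • gen s = (dehornoyClass S • gen s) ^ l := by
  apply cp_injective
  rw [cp_dehornoyClass_nsmul_pow, cp_nsmul, cp_gen]; simp

/-- The key computation: the twist by `λ_a` changes the coordinate that is translated, but the
translation does not depend on `b`. -/
theorem cp_mul_dehornoyClass_nsmul_pow_mul (a b : StructureGroup S) (s : S) (k : ℕ) :
    cp (a * (dehornoyClass S • gen s) ^ k * b) =
      cp (a * b) + Finsupp.single (lam a s) ((k : ℤ) * dehornoyClass S) := by
  rw [mul_assoc, cp_mul, cp_mul, cp_dehornoyClass_nsmul_pow, lam_dehornoyClass_nsmul_pow, act_one,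
    map_add, act_single, cp_mul]
  abel

/-- The kernel of `G → Germ S l` is the preimage of `(l d ℤ)^S` under `cp`. -/
theorem mem_normalClosure_iff (l : ℕ) (g : StructureGroup S) :
    g ∈ Subgroup.normalClosure
      (Set.range fun s : S => (l * dehornoyClass S) • (gen s : StructureGroup S)) ↔
      ∀ s, ((l * dehornoyClass S : ℕ) : ℤ) ∣ cp g s := by
  set N : ℕ := l * dehornoyClass S with hN
  constructor
  · intro hg
    -- The condition `lam g = 1` makes `cp` additive on `K`; divisibility alone is not visibly
    -- stable under products.
    let K : Subgroup (StructureGroup S) :=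
      { carrier := {g | lam g = 1 ∧ ∀ s, (N : ℤ) ∣ cp g s}
        one_mem' := by simp
        mul_mem' := by
          rintro a b ⟨ha, ha'⟩ ⟨hb, hb'⟩
          refine ⟨by rw [map_mul, ha, hb, one_mul], fun s => ?_⟩
          rw [cp_mul, ha, act_one]
          exact dvd_add (ha' s) (hb' s)
        inv_mem' := by
          rintro a ⟨ha, ha'⟩
          refine ⟨by rw [map_inv, ha, inv_one], fun s => ?_⟩
          rw [cp_inv, ha, inv_one, act_one]
          exact (dvd_neg).mpr (ha' s) }
    have hK : K.Normal := ⟨by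
      rintro a ⟨ha, ha'⟩ b
      have h : lam (b * a * b⁻¹) = 1 := by
        rw [map_mul, map_mul, ha, mul_one, ← map_mul, mul_inv_cancel, map_one]
      have h2 : cp (b * a * b⁻¹) = act (lam b) (cp a) := by
        have h3 := cp_mul (b * a * b⁻¹) b
        rw [inv_mul_cancel_right, h, act_one, cp_mul, add_comm] at h3
        exact (add_right_cancel h3).symm
      refine ⟨h, fun s => ?_⟩
      rw [h2, act_apply]
      exact ha' _⟩
    have hle : Subgroup.normalClosure (Set.range fun s : S => N • (gen s : StructureGroup S)) ≤ K := by
      refine Subgroup.normalClosure_le_normal ?_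
      rintro _ ⟨s, rfl⟩
      refine ⟨?_, fun t => ?_⟩
      · rw [hN]
        simp only [mul_dehornoyClass_nsmul, lam_dehornoyClass_nsmul_pow]
      · simp only [cp_nsmul, cp_gen, Finsupp.smul_apply, nsmul_eq_mul]
        exact dvd_mul_right _ _
    exact (hle hg).2
  · intro hg
    -- Induction on `v`, one coordinate at a time; `g` stays general because it gets replaced by `y
    -- ^ (-k) * g` with `y = s^{[ld]}`.
    have key : ∀ v : S →₀ ℤ, ∀ g : StructureGroup S, cp g = (N : ℤ) • v →
        g ∈ Subgroup.normalClosure (Set.range fun s : S => N • (gen s : StructureGroup S)) := by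
      intro v
      induction v using Finsupp.induction with
      | zero =>
        intro g hg
        have : g = 1 := cp_injective (by rw [hg, cp_one, smul_zero])
        rw [this]; exact one_mem _
      | single_add s k v _ _ ih =>
        intro g hg
        set y : StructureGroup S := N • gen s with hy
        have hy1 : lam y = 1 := by
          rw [hy, hN, mul_dehornoyClass_nsmul, lam_dehornoyClass_nsmul_pow]
        have hyz : ∀ k : ℤ, cp (y ^ k) = (N : ℤ) • Finsupp.single s k := by
          have hn : ∀ k : ℕ, cp (y ^ k) = (N : ℤ) • Finsupp.single s (k : ℤ) := by
            intro k
            induction k with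
            | zero => simp
            | succ k ih =>
              rw [pow_succ, cp_mul, ih, map_pow, hy1, one_pow, act_one, hy, cp_nsmul, cp_gen,
                Nat.cast_succ, Finsupp.single_add, smul_add, natCast_zsmul,
                natCast_zsmul]
          intro k
          obtain ⟨n, rfl | rfl⟩ := Int.eq_nat_or_neg k
          · rw [zpow_natCast, hn]
          · rw [zpow_neg, zpow_natCast, cp_inv, map_pow, hy1, one_pow, inv_one, act_one, hn,
              Finsupp.single_neg, smul_neg]
        have hmem : y ^ (-k) * g ∈ Subgroup.normalClosure
            (Set.range fun s : S => N • (gen s : StructureGroup S)) := by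
          apply ih
          rw [cp_mul, hyz, map_zpow, hy1, one_zpow, act_one, hg, ← smul_add, ← add_assoc,
            ← Finsupp.single_add, neg_add_cancel, Finsupp.single_zero, zero_add]
        have hymem : y ∈ Subgroup.normalClosure
            (Set.range fun s : S => N • (gen s : StructureGroup S)) :=
          Subgroup.subset_normalClosure ⟨s, rfl⟩
        have := mul_mem (zpow_mem hymem k) hmem
        rwa [← mul_assoc, ← zpow_add, add_neg_cancel, zpow_zero, one_mul] at this
    refine key ((cp g).mapRange (· / (N : ℤ)) (by simp)) g ?_
    ext s
    simp [Int.mul_ediv_cancel' (hg s)]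

/-- The coordinates of `cp (g⁻¹ * h)` are those of `cp h - cp g` up to a permutation, which does not
affect divisibility of all of them. -/
theorem germ_mk_eq_mk_iff (l : ℕ) (g h : StructureGroup S) :
    (QuotientGroup.mk g : Germ S l) = QuotientGroup.mk h ↔
      ∀ s, cp g s ≡ cp h s [ZMOD ((l * dehornoyClass S : ℕ) : ℤ)] := by
  rw [QuotientGroup.eq, mem_normalClosure_iff]
  have h1 : cp (g⁻¹ * h) = act (lam g)⁻¹ (cp h - cp g) := by
    rw [cp_mul, cp_inv, map_inv, map_sub]; abel
  simp only [h1, act_apply, Int.modEq_iff_dvd, Finsupp.sub_apply]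
  exact ⟨fun H s => by simpa using H ((lam g)⁻¹ s), fun H s => H _⟩

/-! ### Box representatives and reduced expressions. -/

/-- The elements of the germ are parametrized by `{0, …, l d - 1}^S`. -/
noncomputable def boxEquiv (S : Type*) [CycleSet S] [Finite S] {l : ℕ} (hl : 0 < l) :
    (S → Fin (l * dehornoyClass S)) ≃ Germ S l :=
  Equiv.ofBijective
    (fun p => QuotientGroup.mk
      ((cpEquiv S).symm (Finsupp.equivFunOnFinite.symm fun s => ((p s : ℕ) : ℤ)))) <| by
    have hcp : ∀ v, cp ((cpEquiv S).symm v) = v := (cpEquiv S).apply_symm_apply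
    constructor
    · intro p q hpq
      have h := (germ_mk_eq_mk_iff l _ _).mp hpq
      ext s
      have h2 := h s
      rw [hcp, hcp] at h2
      simp only [Finsupp.equivFunOnFinite_symm_apply_apply, Int.natCast_modEq_iff] at h2
      exact h2.eq_of_lt_of_lt (p s).2 (q s).2
    · intro g
      obtain ⟨g, rfl⟩ := QuotientGroup.mk_surjective g
      have hN : 0 < l * dehornoyClass S := Nat.mul_pos hl (dehornoyClass_spec S).1
      have hN' : (0 : ℤ) < (l * dehornoyClass S : ℕ) := by exact_mod_cast hN
      have h0 : ∀ s, 0 ≤ cp g s % ((l * dehornoyClass S : ℕ) : ℤ) := fun s =>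
        Int.emod_nonneg _ hN'.ne'
      have h1 : ∀ s, cp g s % ((l * dehornoyClass S : ℕ) : ℤ) < ((l * dehornoyClass S : ℕ) : ℤ) :=
        fun s => Int.emod_lt_of_pos _ hN'
      refine ⟨fun s => ⟨(cp g s % ((l * dehornoyClass S : ℕ) : ℤ)).toNat, ?_⟩, ?_⟩
      · have := h0 s
        have := h1 s
        omega
      · refine (germ_mk_eq_mk_iff l _ _).mpr fun s => ?_
        rw [hcp]
        simp only [Finsupp.equivFunOnFinite_symm_apply_apply]
        rw [Int.toNat_of_nonneg (h0 s)]
        exact Int.mod_modEq _ _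

/-- The element of the structure group with coordinates in `{0, …, l d - 1}` that represents an
element of the germ. -/
noncomputable def germLift {l : ℕ} (hl : 0 < l) (g : Germ S l) : StructureGroup S :=
  (cpEquiv S).symm (Finsupp.equivFunOnFinite.symm fun s => (((boxEquiv S hl).symm g s : ℕ) : ℤ))

theorem cp_germLift {l : ℕ} (hl : 0 < l) (g : Germ S l) (s : S) :
    cp (germLift hl g) s = ((boxEquiv S hl).symm g s : ℕ) := by
  have hcp : ∀ v, cp ((cpEquiv S).symm v) = v := (cpEquiv S).apply_symm_apply
  rw [germLift, hcp, Finsupp.equivFunOnFinite_symm_apply_apply]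

theorem mk_germLift {l : ℕ} (hl : 0 < l) (g : Germ S l) :
    (QuotientGroup.mk (germLift hl g) : Germ S l) = g :=
  (boxEquiv S hl).apply_symm_apply g

/-- The coordinates of a word are nonnegative, and a nonnegative integer is at least its remainder
modulo `ld`. -/
theorem cp_germLift_le {l : ℕ} (hl : 0 < l) {g : Germ S l} {w : List S} (hw : germWord l w = g)
    (s : S) : cp (germLift hl g) s ≤ cp (word w) s := by
  have h := (germ_mk_eq_mk_iff l _ _).mp (hw.trans (mk_germLift hl g).symm) s
  have h2 : cp (germLift hl g) s < (l * dehornoyClass S : ℕ) := by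
    rw [cp_germLift]; exact_mod_cast ((boxEquiv S hl).symm g s).2
  have h3 : 0 ≤ cp (germLift hl g) s := by rw [cp_germLift]; positivity
  have h4 := cp_word_nonneg w s
  rw [← Int.emod_eq_of_lt h3 h2, ← h]
  have h5 := Int.emod_add_mul_ediv (cp (word w) s) ((l * dehornoyClass S : ℕ) : ℤ)
  have h6 := mul_nonneg (Int.natCast_nonneg (l * dehornoyClass S))
    (Int.ediv_nonneg h4 (Int.natCast_nonneg (l * dehornoyClass S)))
  linarith

theorem exists_isReducedExpr {l : ℕ} (hl : 0 < l) (g : Germ S l) :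
    ∃ w : List S, IsReducedExpr l w g ∧ word w = germLift hl g := by
  obtain ⟨w, hw⟩ := exists_word_cp (cp (germLift hl g)) fun s => by
    rw [cp_germLift]; positivity
  have hw' := cp_injective hw
  refine ⟨w, ⟨by rw [germWord, hw', mk_germLift], fun w' h => ?_⟩, hw'⟩
  have h1 : 0 ≤ (cp (word w') - cp (word w)).degree := degree_nonneg_of_forall_nonneg fun s => by
    rw [hw']; exact sub_nonneg.mpr (cp_germLift_le hl h s)
  rw [map_sub, degree_cp_word, degree_cp_word] at h1
  omega

/-- A reduced word dominates the box representative coordinatewise and has no larger degree, so all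
coordinates agree. Injectivity of `cp` then makes the value in `G` independent of the reduced
expression. -/
theorem IsReducedExpr.word_eq {l : ℕ} (hl : 0 < l) {g : Germ S l} {w : List S}
    (hw : IsReducedExpr l w g) : word w = germLift hl g := by
  obtain ⟨w', h1, h2⟩ := exists_isReducedExpr hl g
  rw [← h2]
  apply cp_injective
  have hlen := hw.2 w' h1.1
  have hle : ∀ s, 0 ≤ (cp (word w) - cp (word w')) s := fun s => by
    rw [h2]; exact sub_nonneg.mpr (cp_germLift_le hl hw.1 s)
  have hdeg : (cp (word w) - cp (word w')).degree ≤ 0 := by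
    rw [map_sub, degree_cp_word, degree_cp_word]; omega
  have hzero : (cp (word w) - cp (word w')).degree = 0 := le_antisymm hdeg (degree_nonneg_of_forall_nonneg hle)
  rw [Finsupp.degree_apply, Finset.sum_eq_zero_iff_of_nonneg fun s _ => hle s] at hzero
  rw [← sub_eq_zero]
  ext s
  by_contra h
  exact h (hzero s (Finsupp.mem_support_iff.mpr h))

/-! ### The Hecke algebra: spanning and linear independence. -/

variable {R : Type u} [CommRing R]

/-- The image of an element of the structure group in the Hecke algebra. -/
noncomputable def heckeOf (P : R[X]) (g : StructureGroup S) : HeckeAlgebra S P :=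
  (heckeIdeal S P).ringCon.mk' (MonoidAlgebra.of R (StructureGroup S) g)

theorem heckeOf_word (P : R[X]) (w : List S) :
    heckeOf P (word w) = (w.map (heckeGen P)).prod := by
  rw [heckeOf, word, map_list_prod, map_list_prod, List.map_map, List.map_map]
  rfl

theorem mul_aeval_mul_eq_sum (P : R[X]) (a b : StructureGroup S) (s : S) :
    MonoidAlgebra.of R _ a *
        aeval (MonoidAlgebra.of R (StructureGroup S) (dehornoyClass S • gen s)) P *
        MonoidAlgebra.of R _ b =
      ∑ k ∈ Finset.range (P.natDegree + 1), P.coeff k •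
        MonoidAlgebra.of R _ (a * (dehornoyClass S • gen s) ^ k * b) := by
  rw [aeval_eq_sum_range, Finset.mul_sum, Finset.sum_mul]
  refine Finset.sum_congr rfl fun k _ => ?_
  rw [mul_smul_comm, smul_mul_assoc, map_mul, map_mul, map_pow]

theorem mk_eq_zero_iff (P : R[X]) (x : MonoidAlgebra R (StructureGroup S)) :
    (heckeIdeal S P).ringCon.mk' x = 0 ↔ x ∈ heckeIdeal S P := by
  rw [TwoSidedIdeal.mem_iff, ← map_zero (heckeIdeal S P).ringCon.mk']
  exact RingCon.eq _

theorem mk_smul (P : R[X]) (r : R) (x : MonoidAlgebra R (StructureGroup S)) :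
    (heckeIdeal S P).ringCon.mk' (r • x) = r • (heckeIdeal S P).ringCon.mk' x := rfl

/-- Multiplying `P(s^{[d]})` on the right by the element with `cp = v` yields a linear recurrence of
step `d` in the coordinate `s`. -/
theorem sum_coeff_smul_heckeOf (P : R[X]) (v : S →₀ ℤ) (s : S) :
    ∑ k ∈ Finset.range (P.natDegree + 1), P.coeff k •
      heckeOf P ((cpEquiv S).symm (v + Finsupp.single s ((k : ℤ) * dehornoyClass S))) = 0 := by
  have hcp : ∀ v, cp ((cpEquiv S).symm v) = v := (cpEquiv S).apply_symm_apply
  have hmem : MonoidAlgebra.of R _ 1 *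
        aeval (MonoidAlgebra.of R (StructureGroup S) (dehornoyClass S • gen s)) P *
        MonoidAlgebra.of R _ ((cpEquiv S).symm v) ∈ heckeIdeal S P :=
    TwoSidedIdeal.mul_mem_right _ _ _
      (TwoSidedIdeal.mul_mem_left _ _ _ (TwoSidedIdeal.subset_span ⟨s, rfl⟩))
  rw [← mk_eq_zero_iff, mul_aeval_mul_eq_sum, map_sum] at hmem
  rw [← hmem]
  refine Finset.sum_congr rfl fun k _ => ?_
  rw [mk_smul, ← heckeOf]
  congr 2
  apply cp_injective
  rw [hcp, cp_mul_dehornoyClass_nsmul_pow_mul, one_mul, hcp, map_one, Equiv.Perm.one_apply]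

theorem span_heckeOf_germLift (P : R[X]) (hl : 0 < P.natDegree) (hlead : IsUnit P.leadingCoeff)
    (hconst : IsUnit (P.coeff 0)) :
    Submodule.span R (Set.range fun g : Germ S P.natDegree => heckeOf P (germLift hl g)) = ⊤ := by
  classical
  have := Fintype.ofFinite S
  set N := Submodule.span R (Set.range fun g : Germ S P.natDegree => heckeOf P (germLift hl g))
    with hN
  have hbox : ∀ v : S →₀ ℤ, (∀ s, 0 ≤ v s ∧ v s < P.natDegree * dehornoyClass S) →
      heckeOf P ((cpEquiv S).symm v) ∈ N := by
    intro v hv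
    refine Submodule.subset_span ⟨boxEquiv S hl fun s => ⟨(v s).toNat, ?_⟩, ?_⟩
    · have h1 := (hv s).1
      have h2 := (hv s).2
      zify
      rwa [Int.toNat_of_nonneg h1]
    · simp only [germLift, Equiv.symm_apply_apply]
      congr 2
      ext s
      simp [(hv s).1]
  -- The coordinates in `F` are unrestricted and the others lie in the box; `F` grows from empty to
  -- all of `S`.
  have hall : ∀ (F : Finset S) (v : S →₀ ℤ),
      (∀ s ∉ F, 0 ≤ v s ∧ v s < P.natDegree * dehornoyClass S) →
      heckeOf P ((cpEquiv S).symm v) ∈ N := by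
    intro F
    induction F using Finset.induction_on with
    | empty => exact fun v hv => hbox v fun s => hv s (Finset.notMem_empty s)
    | insert t F _ ih =>
      intro v hv
      -- With the other coordinates fixed, the recurrence in coordinate `t` reduces to values of
      -- that coordinate in the box, where `ih` applies.
      have h := N.mem_of_linear_recurrence P hlead hconst (dehornoyClass_spec S).1
        (fun m => heckeOf P ((cpEquiv S).symm (v.update t m))) (fun m => ?_) (fun m h0 h1 => ?_)
        (v t)
      · simpa using h
      · rw [← sum_coeff_smul_heckeOf P (v.update t m) t]
        refine Finset.sum_congr rfl fun k _ => ?_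
        congr 3
        ext s
        by_cases hs : s = t
        · subst hs; simp
        · simp [Finsupp.update_apply, hs]
      · refine ih _ fun s hs => ?_
        by_cases hst : s = t
        · subst hst; simpa using ⟨h0, h1⟩
        · simpa [Finsupp.update_apply, hst] using hv s (by simp [hst, hs])
  have hof : ∀ g : StructureGroup S, heckeOf P g ∈ N := fun g => by
    have := hall Finset.univ (cpEquiv S g) (by simp)
    rwa [Equiv.symm_apply_apply] at this
  rw [eq_top_iff]
  rintro x -
  obtain ⟨x, rfl⟩ := (heckeIdeal S P).ringCon.mk'_surjective x
  induction x using MonoidAlgebra.induction_on with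
  | of g => exact hof g
  | add x y hx hy => rw [map_add]; exact N.add_mem hx hy
  | smul r x hx => rw [mk_smul]; exact N.smul_mem r hx

-- The separating map `φ` sends `g` to the pure tensor of the powers `x ^ cp g s`, where `P(x^d) =
-- 0`. It is only defined as a linear map, as `cp` is twisted by `λ`, so its vanishing on the ideal
-- is checked on all products `a * P(s^{[d]}) * b`.
open PiTensorProduct in
theorem linearIndependent_heckeOf_germLift (P : R[X]) (hl : 0 < P.natDegree)
    (hlead : IsUnit P.leadingCoeff) (hconst : IsUnit (P.coeff 0)) :
    LinearIndependent R fun g : Germ S P.natDegree => heckeOf P (germLift hl g) := by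
  classical
  obtain ⟨B, _, _, x, b, hb, hx⟩ :=
    P.exists_unit_powerBasis_aeval_pow hlead hconst (dehornoyClass_spec S).1
  let φ : MonoidAlgebra R (StructureGroup S) →ₗ[R] PiTensorProduct R fun _ : S => B :=
    (MonoidAlgebra.basis (StructureGroup S) R).constr R
      fun g => tprod R fun s => (↑(x ^ cp g s) : B)
  have hφ : ∀ g, φ (MonoidAlgebra.of R _ g) = tprod R fun s => (↑(x ^ cp g s) : B) := by
    intro g
    rw [← Module.Basis.constr_basis (MonoidAlgebra.basis (StructureGroup S) R) R
      (fun g => tprod R fun s => (↑(x ^ cp g s) : B)) g]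
    simp [φ]
  have hgen : ∀ (a b : StructureGroup S) (s : S), φ (MonoidAlgebra.of R _ a *
        aeval (MonoidAlgebra.of R (StructureGroup S) (dehornoyClass S • gen s)) P *
        MonoidAlgebra.of R _ b) = 0 := by
    intro a b s
    rw [mul_aeval_mul_eq_sum, map_sum]
    set m : S → B := fun t => (↑(x ^ cp (a * b) t) : B)
    -- Only the factor at `lam a s` depends on `k`; by multilinearity the sum over `k` puts `P(x^d)
    -- = 0` into that factor.
    have hterm : ∀ k, φ (P.coeff k • MonoidAlgebra.of R _ (a * (dehornoyClass S • gen s) ^ k * b)) =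
        tprod R (Function.update m (lam a s)
          (P.coeff k • ((x : B) ^ dehornoyClass S) ^ k * m (lam a s))) := by
      intro k
      rw [map_smul, hφ, smul_mul_assoc, MultilinearMap.map_update_smul,
        cp_mul_dehornoyClass_nsmul_pow_mul]
      congr 2
      ext t
      by_cases ht : t = lam a s
      · subst ht
        rw [Function.update_self, Finsupp.add_apply, Finsupp.single_eq_same, zpow_add, mul_comm,
          Units.val_mul]
        congr 1
        rw [mul_comm, zpow_mul, zpow_natCast, zpow_natCast, Units.val_pow_eq_pow_val,
          Units.val_pow_eq_pow_val]
      · rw [Function.update_of_ne ht, Finsupp.add_apply, Finsupp.single_eq_of_ne ht, add_zero]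
    rw [Finset.sum_congr rfl fun k _ => hterm k, ← MultilinearMap.map_update_sum,
      ← Finset.sum_mul, ← aeval_eq_sum_range, hx, zero_mul, MultilinearMap.map_update_zero]
  have hker : ∀ y ∈ heckeIdeal S P, φ y = 0 := by
    intro y hy
    rw [heckeIdeal, TwoSidedIdeal.mem_span_iff_mem_addSubgroup_closure] at hy
    induction hy using AddSubgroup.closure_induction with
    | zero => exact map_zero φ
    | add y z _ _ hy hz => rw [map_add, hy, hz, add_zero]
    | neg y _ hy => rw [map_neg, hy, neg_zero]
    | mem y hy =>
      -- The ideal is additively generated by products `p * P(s^{[d]}) * q`; bilinearity reduces `p`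
      -- and `q` to group elements.
      obtain ⟨_, ⟨p, -, _, ⟨s, rfl⟩, rfl⟩, q, -, rfl⟩ := hy
      simp only
      induction p using MonoidAlgebra.induction_on with
      | add p p' hp hp' => rw [add_mul, add_mul, map_add, hp, hp', add_zero]
      | smul r p hp => rw [smul_mul_assoc, smul_mul_assoc, map_smul, hp, smul_zero]
      | of a =>
        induction q using MonoidAlgebra.induction_on with
        | add q q' hq hq' => rw [mul_add, map_add, hq, hq', add_zero]
        | smul r q hq => rw [mul_smul_comm, map_smul, hq, smul_zero]
        | of b => exact hgen a b s
  have hlift : ∀ g : Germ S P.natDegree, φ (MonoidAlgebra.of R _ (germLift hl g)) =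
      Basis.piTensorProduct (fun _ : S => b) ((boxEquiv S hl).symm g) := by
    intro g
    rw [hφ, Basis.piTensorProduct_apply]
    congr 1
    ext s
    rw [cp_germLift, hb, zpow_natCast, Units.val_pow_eq_pow_val]
  have hind : LinearIndependent R fun g : Germ S P.natDegree =>
      φ (MonoidAlgebra.of R _ (germLift hl g)) := by
    -- Box representatives have exponents in `{0, …, ld-1}`, so their images are distinct members of
    -- the product basis.
    simp only [hlift]
    exact (Basis.piTensorProduct fun _ : S => b).linearIndependent.comp _
      (boxEquiv S hl).symm.injective
  rw [linearIndependent_iff'] at hind ⊢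
  intro t c hc
  refine hind t c ?_
  have h : (heckeIdeal S P).ringCon.mk'
      (∑ g ∈ t, c g • MonoidAlgebra.of R _ (germLift hl g)) = 0 := by
    rw [map_sum]; exact hc
  have h2 := hker _ ((mk_eq_zero_iff P _).mp h)
  rw [map_sum] at h2
  simpa only [map_smul] using h2

/-! ### The order of the germ and the conclusion. -/

theorem card_germ (S : Type*) [CycleSet S] [Finite S] {l : ℕ} (hl : 0 < l) :
    Nat.card (Germ S l) = (l * dehornoyClass S) ^ Nat.card S := by
  rw [← Nat.card_congr (boxEquiv S hl), Nat.card_fun, Nat.card_fin]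

end CycleSet

theorem theorem2 {S : Type*} [CycleSet S] [Finite S] {R : Type*} [CommRing R] (P : Polynomial R)
    (l : ℕ) (hl : 0 < l) (hdeg : P.natDegree = l) (hlead : IsUnit P.leadingCoeff)
    (hconst : IsUnit (P.coeff 0)) :
    (∀ g : CycleSet.Germ S l, ∃ w : List S, CycleSet.IsReducedExpr l w g) ∧
    (∃ T : Module.Basis (CycleSet.Germ S l) R (CycleSet.HeckeAlgebra S P),
      ∀ (g : CycleSet.Germ S l) (w : List S), CycleSet.IsReducedExpr l w g →
        T g = (w.map (CycleSet.heckeGen P)).prod) ∧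
    Module.Free R (CycleSet.HeckeAlgebra S P) ∧
    Module.Finite R (CycleSet.HeckeAlgebra S P) ∧
    Module.finrank R (CycleSet.HeckeAlgebra S P) = (l * CycleSet.dehornoyClass S) ^ Nat.card S ∧
    Nat.card (CycleSet.Germ S l) = (l * CycleSet.dehornoyClass S) ^ Nat.card S := by
  subst hdeg
  -- Over the zero ring every polynomial has `natDegree` zero, against `0 < l`; nontriviality is
  -- what lets `finrank` count the basis.
  have : Nontrivial R := by
    by_contra h
    rw [not_nontrivial_iff_subsingleton] at h
    rw [Subsingleton.elim P 0, Polynomial.natDegree_zero] at hl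
    exact lt_irrefl 0 hl
  have : Finite (CycleSet.Germ S P.natDegree) := Finite.of_equiv _ (CycleSet.boxEquiv S hl)
  let T : Module.Basis (CycleSet.Germ S P.natDegree) R (CycleSet.HeckeAlgebra S P) :=
    Module.Basis.mk (CycleSet.linearIndependent_heckeOf_germLift P hl hlead hconst)
      (CycleSet.span_heckeOf_germLift P hl hlead hconst).ge
  refine ⟨fun g => ?_, ⟨T, fun g w hw => ?_⟩, .of_basis T, .of_basis T, ?_,
    CycleSet.card_germ S hl⟩
  · obtain ⟨w, hw, -⟩ := CycleSet.exists_isReducedExpr hl g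
    exact ⟨w, hw⟩
  · rw [Module.Basis.mk_apply, ← hw.word_eq hl, CycleSet.heckeOf_word]
  · rw [Module.finrank_eq_nat_card_basis T, CycleSet.card_germ S hl]
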